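/- Let $0<m<M<\infty$ and $\kappa:=M/m$. For a Borel probability measure $\mu$ on $\mathbb R$ (of arbitrary support) put $$J(\mu):=\sup_{\lambda\in[m,M]}\ \mathbb E_{\beta\sim\mu}\log\bigl|1-\beta^{-1}\lambda\bigr|\in[-\infty,\infty],$$ where $\log 0=-\infty$, the integrand is $+\infty$ at $\beta=0$, and $\mathbb E[f]:=\mathbb E[f^+]-\mathbb E[f^-]$ (with $\infty-\infty:=-\infty$). Let $\mathrm{Arcsine}(m,M)$ be the measure on $\mathbb R$ with Lebesgue density $$\beta\mapsto\frac{\mathbf 1_{\beta\in(m,M)}}{\pi\sqrt{(M-\beta)(\beta-m)}}.$$ Then $\mathrm{Arcsine}(m,M)$ is a probability measure, the extremal problem of minimizing $J$ over all Borel probability measures on $\mathbb R$ has optimal value $$\inf_{\mu}J(\mu)=\log\frac{\sqrt\kappa-1}{\sqrt\kappa+1},$$ and $\mathrm{Arcsine}(m,M)$ is its unique minimizer: a probability measure $\mu$ on $\mathbb R$ satisfies $J(\mu)\le J(\nu)$ for all probability measures $\nu$ on $\mathbb R$ if and only if $\mu=\mathrm{Arcsine}(m,M)$. -/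

import Mathlib

open MeasureTheory Set
open scoped ENNReal

noncomputable section

/-- The arcsine distribution on `(m, M)`: the measure on `ℝ` with Lebesgue density
`1_{β ∈ (m, M)} / (π √((M - β)(β - m)))`. -/
def arcsineMeasure (m M : ℝ) : Measure ℝ :=
  volume.withDensity fun β =>
    ENNReal.ofReal
      ((Ioo m M).indicator (fun β => 1 / (Real.pi * Real.sqrt ((M - β) * (β - m)))) β)

/-- The contraction factor `|1 - β⁻¹ λ|` of a gradient step with inverse stepsize `β` on a
quadratic of curvature `lam`; it is `∞` at `β = 0` (an infinite stepsize). -/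
def contractionFactor (lam β : ℝ) : ℝ≥0∞ :=
  if β = 0 then ⊤ else ENNReal.ofReal |1 - β⁻¹ * lam|

/-- Expectation of an extended-real random variable, `E[f⁺] - E[f⁻]` in `[-∞, ∞]`. -/
def extExpectation (μ : Measure ℝ) (f : ℝ → EReal) : EReal :=
  ((∫⁻ β, (f β).toENNReal ∂μ : ℝ≥0∞) : EReal) -
    ((∫⁻ β, (-f β).toENNReal ∂μ : ℝ≥0∞) : EReal)

/-- The objective `sup_{λ ∈ [m, M]} E_{β ∼ μ} log |1 - β⁻¹ λ|`, where `log 0 = -∞`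
(`ENNReal.log` is the extended logarithm `[0, ∞] → [-∞, ∞]`). -/
def stepsizeObjective (m M : ℝ) (μ : Measure ℝ) : EReal :=
  ⨆ lam ∈ Icc m M, extExpectation μ fun β => ENNReal.log (contractionFactor lam β)

end

/-! The argument is minimax duality from logarithmic potential theory. The arcsine law is the
equilibrium measure of `[m, M]`: its potential `∫ log |y - x|` is constant for `x` in the interval
(`arcsineMeasure_log_potential`), so every curvature gives the same value, which is the claimed
rate.

For the lower bound, average the objective over a dual law on curvatures, the sweeping `ρ_0` of the
Dirac mass at `0` onto `[m, M]`. Against `ρ_0`, every nonzero stepsize parameter `β` costs at least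
the rate, with equality exactly for `β ∈ [m, M]` (`sweptMeasure_log_potential` at `w = 0`); Fubini
concludes (`integral_integral_log_contraction`).

If `μ` is optimal, both inequalities are tight: `μ` lives on `[m, M]` and its potential is constant
almost everywhere there. Integrating this constant against the swept measure `ρ_w`, for each `w <
m`, gives the potential of `μ` at `w` up to one additive constant
(`integral_log_sub_of_stepsizeObjective_le`). Such exterior data determine `μ`
(`eq_of_integral_log_sub_eq`). -/

/-! ### The arcsine law as the image of the uniform law on `(0, π)` under an affine cosine -/

lemma image_affine_cos_Ioo {a b : ℝ} (hab : a < b) :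
    (fun θ => (a + b) / 2 + (b - a) / 2 * Real.cos θ) '' Ioo 0 Real.pi = Ioo a b := by
  have hr : 0 < (b - a) / 2 := by linarith
  ext y
  constructor
  · rintro ⟨θ, ⟨h0, h1⟩, rfl⟩
    have hs := Real.sin_pos_of_pos_of_lt_pi h0 h1
    have hsq := Real.sin_sq_add_cos_sq θ
    have h2 : Real.cos θ < 1 := by nlinarith
    have h3 : -1 < Real.cos θ := by nlinarith
    constructor <;> simp only <;> nlinarith
  · rintro ⟨h0, h1⟩
    have e1 : -1 < (y - (a + b) / 2) / ((b - a) / 2) := by rw [lt_div_iff₀ hr]; linarith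
    have e2 : (y - (a + b) / 2) / ((b - a) / 2) < 1 := by rw [div_lt_one hr]; linarith
    refine ⟨Real.arccos ((y - (a + b) / 2) / ((b - a) / 2)), ⟨Real.arccos_pos.2 e2, ?_⟩, ?_⟩
    · refine lt_of_le_of_ne (Real.arccos_le_pi _) fun h => ?_
      rw [Real.arccos_eq_pi] at h
      linarith
    · simp only
      rw [Real.cos_arccos e1.le e2.le, mul_div_cancel₀ _ hr.ne']
      ring

lemma arcsineMeasure_eq_map {a b : ℝ} (hab : a < b) :
    arcsineMeasure a b = (ENNReal.ofReal Real.pi⁻¹ • volume.restrict (Ioo 0 Real.pi)).map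
      (fun θ => (a + b) / 2 + (b - a) / 2 * Real.cos θ) := by
  have hba : b - a ≠ 0 := (sub_pos.2 hab).ne'
  have hr : 0 < (b - a) / 2 := by linarith
  have hmeas : Measurable fun β : ℝ => ENNReal.ofReal ((Ioo a b).indicator
      (fun β => 1 / (Real.pi * Real.sqrt ((b - β) * (β - a)))) β) :=
    ENNReal.measurable_ofReal.comp (Measurable.indicator (by fun_prop) measurableSet_Ioo)
  refine Measure.ext_of_lintegral _ fun g hg => ?_
  rw [arcsineMeasure, lintegral_withDensity_eq_lintegral_mul _ hmeas hg,
    lintegral_map hg (by fun_prop), lintegral_smul_measure]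
  have h1 : ∫⁻ β, ((fun β : ℝ => ENNReal.ofReal ((Ioo a b).indicator
      (fun β => 1 / (Real.pi * Real.sqrt ((b - β) * (β - a)))) β)) * g) β =
      ∫⁻ β in Ioo a b, ENNReal.ofReal (1 / (Real.pi * Real.sqrt ((b - β) * (β - a)))) * g β := by
    rw [← lintegral_indicator measurableSet_Ioo]
    refine lintegral_congr fun β => ?_
    by_cases h : β ∈ Ioo a b <;> simp [h]
  have hinj : InjOn (fun θ => (a + b) / 2 + (b - a) / 2 * Real.cos θ) (Ioo 0 Real.pi) := by
    intro x hx y hy h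
    refine Real.injOn_cos ⟨hx.1.le, hx.2.le⟩ ⟨hy.1.le, hy.2.le⟩ ?_
    exact mul_left_cancel₀ hr.ne' (add_left_cancel h)
  rw [h1, ← image_affine_cos_Ioo hab, lintegral_image_eq_lintegral_abs_deriv_mul measurableSet_Ioo
    (f' := fun θ => (b - a) / 2 * (-Real.sin θ))
    (fun θ _ => (((Real.hasDerivAt_cos θ).const_mul _).const_add _).hasDerivWithinAt) hinj,
    smul_eq_mul, ← lintegral_const_mul _ (by fun_prop)]
  refine setLIntegral_congr_fun measurableSet_Ioo fun θ hθ => ?_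
  have hs := Real.sin_pos_of_pos_of_lt_pi hθ.1 hθ.2
  have e1 : (b - ((a + b) / 2 + (b - a) / 2 * Real.cos θ)) *
      ((a + b) / 2 + (b - a) / 2 * Real.cos θ - a) = ((b - a) / 2 * Real.sin θ) ^ 2 := by
    linear_combination ((b - a) / 2) ^ 2 * (-Real.sin_sq_add_cos_sq θ)
  have e2 : |(b - a) / 2 * -Real.sin θ| = (b - a) / 2 * Real.sin θ := by
    rw [mul_neg, abs_neg, abs_of_pos (by positivity)]
  rw [e1, Real.sqrt_sq (by positivity), e2, ← mul_assoc, ← ENNReal.ofReal_mul (by positivity)]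
  congr 2
  field_simp

lemma isProbabilityMeasure_arcsineMeasure {a b : ℝ} (hab : a < b) :
    IsProbabilityMeasure (arcsineMeasure a b) := by
  rw [arcsineMeasure_eq_map hab]
  constructor
  rw [Measure.map_apply (by fun_prop) MeasurableSet.univ]
  simp [← ENNReal.ofReal_mul (inv_nonneg.2 Real.pi_pos.le), Real.pi_pos.ne']

lemma arcsineMeasure_absolutelyContinuous (a b : ℝ) :
    arcsineMeasure a b ≪ volume.restrict (Ioo a b) := by
  refine Measure.AbsolutelyContinuous.mk fun s hs h => ?_
  rw [Measure.restrict_apply hs] at h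
  rw [arcsineMeasure, withDensity_apply _ hs]
  calc _ = ∫⁻ β in s, (Ioo a b).indicator (fun β => ENNReal.ofReal
        (1 / (Real.pi * Real.sqrt ((b - β) * (β - a))))) β := by
        refine lintegral_congr fun β => ?_
        by_cases h : β ∈ Ioo a b <;> simp [h]
    _ = 0 := by
        rw [setLIntegral_indicator measurableSet_Ioo, inter_comm]
        exact setLIntegral_measure_zero _ _ h

lemma absolutelyContinuous_arcsineMeasure (a b : ℝ) :
    volume.restrict (Ioo a b) ≪ arcsineMeasure a b := by
  have hmeas : Measurable fun β : ℝ => ENNReal.ofReal ((Ioo a b).indicator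
      (fun β => 1 / (Real.pi * Real.sqrt ((b - β) * (β - a)))) β) :=
    ENNReal.measurable_ofReal.comp (Measurable.indicator (by fun_prop) measurableSet_Ioo)
  refine Measure.AbsolutelyContinuous.mk fun s hs h => ?_
  rw [arcsineMeasure, withDensity_apply_eq_zero hmeas] at h
  rw [Measure.restrict_apply hs]
  refine measure_mono_null (fun x (hx : x ∈ s ∩ Ioo a b) => mem_inter ?_ hx.1) h
  have h1 : 0 < (b - x) * (x - a) := mul_pos (sub_pos.2 hx.2.2) (sub_pos.2 hx.2.1)
  simp only [mem_ofPred_eq, indicator_of_mem hx.2, ne_eq, ENNReal.ofReal_eq_zero, not_le]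
  have := Real.pi_pos
  positivity

/-! ### Logarithmic potential of the arcsine law -/

/-- The value `|2 (cos θ - x)|` in terms of the Joukowski parameter `w` of `x`. -/
lemma abs_two_mul_cos_sub {w : ℂ} {x : ℝ} (hw : w ≠ 0) (hx : w + w⁻¹ = 2 * x) (θ : ℝ) :
    |2 * (Real.cos θ - x)| = ‖circleMap 0 1 θ - w‖ * ‖circleMap 0 1 θ - w⁻¹‖ := by
  have hz : circleMap 0 1 θ ≠ 0 := circleMap_ne_center one_ne_zero
  have h1 : ‖circleMap 0 1 θ‖ = 1 := by simp
  have hc : circleMap 0 1 θ + (circleMap 0 1 θ)⁻¹ = 2 * (Real.cos θ : ℂ) := by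
    simp only [circleMap, Complex.ofReal_one, one_mul, zero_add]
    rw [← Complex.exp_neg, Complex.ofReal_cos, Complex.two_cos, neg_mul]
  have : ((2 * (Real.cos θ - x) : ℝ) : ℂ) * circleMap 0 1 θ =
      (circleMap 0 1 θ - w) * (circleMap 0 1 θ - w⁻¹) := by
    push_cast
    have e : (2 * ((Real.cos θ : ℂ) - x)) = circleMap 0 1 θ + (circleMap 0 1 θ)⁻¹ - (w + w⁻¹) := by
      rw [hc, hx]; ring
    push_cast at e
    rw [e]
    field_simp
    ring
  rw [← norm_mul, ← this, norm_mul, h1, mul_one, Complex.norm_real, Real.norm_eq_abs]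

lemma log_abs_two_mul_cos_sub {w : ℂ} {x : ℝ} (hw : w ≠ 0) (hx : w + w⁻¹ = 2 * x) {θ : ℝ}
    (hθ : Real.cos θ ≠ x) :
    Real.log |2 * (Real.cos θ - x)| =
      Real.log ‖circleMap 0 1 θ - w‖ + Real.log ‖circleMap 0 1 θ - w⁻¹‖ := by
  have h := abs_two_mul_cos_sub hw hx θ
  have h0 : |2 * (Real.cos θ - x)| ≠ 0 := by simpa [sub_eq_zero] using hθ
  rw [h] at h0
  rw [h, Real.log_mul (left_ne_zero_of_mul h0) (right_ne_zero_of_mul h0)]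

lemma countable_cos_eq (x : ℝ) : {θ : ℝ | Real.cos θ = x}.Countable := by
  by_cases h : ∃ y, Real.cos y = x
  · obtain ⟨y, rfl⟩ := h
    have : {θ : ℝ | Real.cos θ = Real.cos y} ⊆
        range (fun k : ℤ => 2 * k * Real.pi + y) ∪ range (fun k : ℤ => 2 * k * Real.pi - y) := by
      intro θ hθ
      obtain ⟨k, hk⟩ := Real.cos_eq_cos_iff.1 (show Real.cos θ = Real.cos y from hθ)
      rcases hk with hk | hk
      · exact Or.inl ⟨-k, by push_cast; linarith⟩
      · exact Or.inr ⟨k, by linarith⟩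
    exact ((countable_range _).union (countable_range _)).mono this
  · convert countable_empty
    ext θ
    simpa using fun hθ => h ⟨θ, hθ⟩

lemma intervalIntegrable_log_abs_two_mul_cos_sub {w : ℂ} {x : ℝ} (hw : w ≠ 0)
    (hx : w + w⁻¹ = 2 * x) :
    IntervalIntegrable (fun θ => Real.log |2 * (Real.cos θ - x)|) volume 0 (2 * Real.pi) ∧
    ∫ θ in (0)..(2 * Real.pi), Real.log |2 * (Real.cos θ - x)| =
      2 * Real.pi * |Real.log ‖w‖| := by
  have i1 : CircleIntegrable (fun z => Real.log ‖z - w‖) 0 1 :=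
    circleIntegrable_log_norm_sub_const 1
  have i2 : CircleIntegrable (fun z => Real.log ‖z - w⁻¹‖) 0 1 :=
    circleIntegrable_log_norm_sub_const 1
  -- The logarithm splits only where the product is nonzero, hence off a countable set of angles.
  have hae : ∀ᵐ θ : ℝ, Real.log ‖circleMap 0 1 θ - w‖ + Real.log ‖circleMap 0 1 θ - w⁻¹‖ =
      Real.log |2 * (Real.cos θ - x)| := by
    have : ∀ᵐ θ : ℝ, Real.cos θ ≠ x := by
      rw [ae_iff]
      simpa using (countable_cos_eq x).measure_zero volume
    filter_upwards [this] with θ hθ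
    exact (log_abs_two_mul_cos_sub hw hx hθ).symm
  constructor
  · exact (IntervalIntegrable.add i1 i2).congr_ae (ae_restrict_of_ae hae)
  -- Jensen's formula gives the two averages `log⁺ ‖w‖` and `log⁺ ‖w⁻¹‖`, whose sum is `|log ‖w‖|`;
  -- which of `w`, `w⁻¹` is chosen is therefore irrelevant.
  · have c1 := circleAverage_log_norm_sub_const_eq_posLog (a := w)
    have c2 := circleAverage_log_norm_sub_const_eq_posLog (a := w⁻¹)
    rw [Real.circleAverage_def, smul_eq_mul, inv_mul_eq_iff_eq_mul₀ (by positivity)] at c1 c2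
    rw [← intervalIntegral.integral_congr_ae (hae.mono fun θ h _ => h),
      intervalIntegral.integral_add i1 i2, c1, c2, ← mul_add]
    congr 1
    have h2 := Real.log_inv ‖w‖
    rw [norm_inv, Real.posLog_apply, Real.posLog_apply, h2]
    rcases le_total 0 (Real.log ‖w‖) with h | h
    · rw [max_eq_right h, max_eq_left (by linarith), abs_of_nonneg h, add_zero]
    · rw [max_eq_left h, max_eq_right (by linarith), abs_of_nonpos h, zero_add]

lemma integral_log_abs_two_mul_cos_sub {w : ℂ} {x : ℝ} (hw : w ≠ 0) (hx : w + w⁻¹ = 2 * x) :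
    IntervalIntegrable (fun θ => Real.log |2 * (Real.cos θ - x)|) volume 0 Real.pi ∧
    ∫ θ in (0)..Real.pi, Real.log |2 * (Real.cos θ - x)| = Real.pi * |Real.log ‖w‖| := by
  obtain ⟨hi, hv⟩ := intervalIntegrable_log_abs_two_mul_cos_sub hw hx
  have hp := Real.pi_pos
  have h1 : IntervalIntegrable (fun θ => Real.log |2 * (Real.cos θ - x)|) volume 0 Real.pi :=
    hi.mono_set (by
      rw [uIcc_of_le hp.le, uIcc_of_le (by positivity)]
      exact Icc_subset_Icc le_rfl (by linarith))
  have h2 : IntervalIntegrable (fun θ => Real.log |2 * (Real.cos θ - x)|) volume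
      Real.pi (2 * Real.pi) :=
    hi.mono_set (by
      rw [uIcc_of_le (by linarith), uIcc_of_le (by positivity)]
      exact Icc_subset_Icc hp.le le_rfl)
  have h3 : ∫ θ in Real.pi..(2 * Real.pi), Real.log |2 * (Real.cos θ - x)| =
      ∫ θ in (0)..Real.pi, Real.log |2 * (Real.cos θ - x)| := by
    have := intervalIntegral.integral_comp_sub_left (a := 0) (b := Real.pi)
      (fun θ => Real.log |2 * (Real.cos θ - x)|) (2 * Real.pi)
    simp only [Real.cos_two_pi_sub, sub_zero] at this
    rw [this]
    congr 1
    ring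
  refine ⟨h1, ?_⟩
  rw [← intervalIntegral.integral_add_adjacent_intervals h1 h2, h3] at hv
  linarith

lemma integral_log_abs_sub_arcsineMeasure {a b x : ℝ} {w : ℂ} (hab : a < b) (hw : w ≠ 0)
    (hx : w + w⁻¹ = 2 * ((x - (a + b) / 2) / ((b - a) / 2) : ℝ)) :
    Integrable (fun y => Real.log |y - x|) (arcsineMeasure a b) ∧
    ∫ y, Real.log |y - x| ∂(arcsineMeasure a b) = Real.log ((b - a) / 4) + |Real.log ‖w‖| := by
  obtain ⟨hi, hv⟩ := integral_log_abs_two_mul_cos_sub hw hx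
  have hr : 0 < (b - a) / 2 := by linarith
  have hp := Real.pi_pos
  set x' := (x - (a + b) / 2) / ((b - a) / 2) with hx'
  have hae : ∀ᵐ θ : ℝ, Real.log ((b - a) / 4) + Real.log |2 * (Real.cos θ - x')| =
      Real.log |(a + b) / 2 + (b - a) / 2 * Real.cos θ - x| := by
    have : ∀ᵐ θ : ℝ, Real.cos θ ≠ x' := by
      rw [ae_iff]
      simpa using (countable_cos_eq x').measure_zero volume
    filter_upwards [this] with θ hθ
    have h0 : |2 * (Real.cos θ - x')| ≠ 0 := by simpa [sub_eq_zero] using hθ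
    rw [← Real.log_mul (by linarith) h0]
    congr 1
    have : (a + b) / 2 + (b - a) / 2 * Real.cos θ - x = (b - a) / 4 * (2 * (Real.cos θ - x')) := by
      have : (b - a) / 2 * x' = x - (a + b) / 2 := mul_div_cancel₀ _ hr.ne'
      linarith
    rw [this, abs_mul ((b - a) / 4) (2 * (Real.cos θ - x')), abs_of_pos (show 0 < (b - a) / 4 by linarith)]
  rw [intervalIntegrable_iff_integrableOn_Ioo_of_le hp.le] at hi
  have hi2 : IntegrableOn (fun θ => Real.log ((b - a) / 4) + Real.log |2 * (Real.cos θ - x')|)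
      (Ioo 0 Real.pi) := by
    refine Integrable.add ?_ hi
    exact integrable_const _
  have hm : Measurable fun y : ℝ => Real.log |y - x| := by fun_prop
  rw [arcsineMeasure_eq_map hab]
  constructor
  · rw [integrable_map_measure hm.aestronglyMeasurable (by fun_prop)]
    exact (hi2.congr (ae_restrict_of_ae hae)).smul_measure ENNReal.ofReal_ne_top
  · rw [integral_map (by fun_prop) hm.aestronglyMeasurable, integral_smul_measure,
      ← integral_congr_ae (ae_restrict_of_ae hae), integral_add (integrable_const _) hi,
      ← integral_Ioc_eq_integral_Ioo, ← integral_Ioc_eq_integral_Ioo,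
      ← intervalIntegral.integral_of_le hp.le, ← intervalIntegral.integral_of_le hp.le, hv,
      ENNReal.toReal_ofReal (by positivity)]
    simp
    field_simp

/-- The Joukowski map folds the unit circle onto `[-1, 1]`: there `w = x + i √(1 - x²)`, and
otherwise `w = x + √(x² - 1)` is real and off the circle. The last clause identifies where the
potential attains its minimum. -/
lemma exists_joukowski (x : ℝ) : ∃ w : ℂ, w ≠ 0 ∧ w + w⁻¹ = 2 * x ∧
    (Real.log ‖w‖ = 0 ↔ |x| ≤ 1) := by
  rcases le_or_gt |x| 1 with h | h
  · have hs : Real.sqrt (1 - x ^ 2) ^ 2 = 1 - x ^ 2 := Real.sq_sqrt (by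
      rw [sub_nonneg, sq_le_one_iff_abs_le_one]; exact h)
    set s := Real.sqrt (1 - x ^ 2)
    have hn : ‖(⟨x, s⟩ : ℂ)‖ = 1 := by
      rw [Complex.norm_def, Complex.normSq_mk, Real.sqrt_eq_one]
      nlinarith
    have h0 : (⟨x, s⟩ : ℂ) ≠ 0 := by
      intro h0; rw [h0, norm_zero] at hn; exact zero_ne_one hn
    refine ⟨⟨x, s⟩, h0, ?_, by simp [hn, h]⟩
    rw [Complex.inv_eq_conj hn, Complex.add_conj]
    simp
  · have hs : Real.sqrt (x ^ 2 - 1) ^ 2 = x ^ 2 - 1 := Real.sq_sqrt (by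
      rw [sub_nonneg, one_le_sq_iff_one_le_abs]; exact h.le)
    set s := Real.sqrt (x ^ 2 - 1)
    have h1 : (x + s) * (x - s) = 1 := by linear_combination -hs
    have h0 : x + s ≠ 0 := left_ne_zero_of_mul_eq_one h1
    have hinv : (x + s)⁻¹ = x - s := inv_eq_of_mul_eq_one_right h1
    refine ⟨((x + s : ℝ) : ℂ), by exact_mod_cast h0, ?_, ?_⟩
    · rw [← Complex.ofReal_inv, hinv]; push_cast; ring
    · refine iff_of_false (fun hl => ?_) (not_le.2 h)
      rw [Complex.norm_real, Real.norm_eq_abs] at hl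
      have h2 : |x + s| = 1 := by
        rcases Real.log_eq_zero.1 hl with h | h | h
        · exact absurd (abs_eq_zero.1 h) h0
        · exact h
        · linarith [abs_nonneg (x + s)]
      have h3 : |x - s| = 1 := by rw [← hinv, abs_inv, h2, inv_one]
      have : |2 * x| ≤ |x + s| + |x - s| := by
        refine le_trans (le_of_eq ?_) (abs_add_le _ _)
        congr 1; ring
      rw [abs_mul, h2, h3, abs_two] at this
      linarith

lemma arcsineMeasure_log_potential {a b : ℝ} (hab : a < b) (x : ℝ) :
    Integrable (fun y => Real.log |y - x|) (arcsineMeasure a b) ∧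
    Real.log ((b - a) / 4) ≤ ∫ y, Real.log |y - x| ∂(arcsineMeasure a b) ∧
    (∫ y, Real.log |y - x| ∂(arcsineMeasure a b) = Real.log ((b - a) / 4) ↔ x ∈ Icc a b) := by
  obtain ⟨w, hw, hx, h⟩ := exists_joukowski ((x - (a + b) / 2) / ((b - a) / 2))
  obtain ⟨hi, hv⟩ := integral_log_abs_sub_arcsineMeasure hab hw hx
  have hr : 0 < (b - a) / 2 := by linarith
  refine ⟨hi, hv ▸ le_add_of_nonneg_right (abs_nonneg _), ?_⟩
  rw [hv, add_eq_left, abs_eq_zero, h, abs_le, le_div_iff₀ hr, div_le_one hr, mem_Icc]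
  constructor <;> rintro ⟨h1, h2⟩ <;> constructor <;> linarith

lemma integral_log_arcsineMeasure {a b : ℝ} (ha : 0 < a) (hab : a < b) :
    ∫ y, Real.log |y| ∂(arcsineMeasure a b) = Real.log ((b - a) / 4) -
      Real.log ((Real.sqrt b - Real.sqrt a) / (Real.sqrt b + Real.sqrt a)) := by
  have hsa : 0 < Real.sqrt a := Real.sqrt_pos.2 ha
  have hsb : Real.sqrt a < Real.sqrt b := Real.sqrt_lt_sqrt ha.le hab
  have ea := Real.sq_sqrt ha.le
  have eb := Real.sq_sqrt (ha.trans hab).le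
  set s := Real.sqrt a
  set t := Real.sqrt b
  have hq0 : 0 < (t - s) / (t + s) := div_pos (by linarith) (by linarith)
  have hq1 : (t - s) / (t + s) ≤ 1 := by rw [div_le_one (by linarith)]; linarith
  have h1 : t - s ≠ 0 := by linarith
  have h2 : t + s ≠ 0 := by linarith
  have h3 : t ^ 2 - s ^ 2 ≠ 0 := by rw [ea, eb]; linarith
  -- With `s = √a` and `t = √b`, the Joukowski equation at the rescaled point `-(a + b) / (b - a)`
  -- has the root `-(t - s) / (t + s)`; this is the source of the rate.
  have key := integral_log_abs_sub_arcsineMeasure (x := 0)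
    (w := ((-((t - s) / (t + s)) : ℝ) : ℂ)) hab
    (by exact_mod_cast (neg_lt_zero.2 hq0).ne) (by
      rw [← Complex.ofReal_inv, ← Complex.ofReal_add, ← Complex.ofReal_ofNat, ← Complex.ofReal_mul]
      congr 1
      rw [← ea, ← eb]
      field_simp
      ring)
  have := key.2
  simp only [sub_zero] at this
  rw [this, Complex.norm_real, Real.norm_eq_abs, abs_neg, abs_of_pos hq0,
    abs_of_nonpos (Real.log_nonpos hq0.le hq1)]
  ring

/-- The logarithm of the contraction rate attached to the condition number `κ`. -/
noncomputable def logRate (κ : ℝ) : ℝ := Real.log ((Real.sqrt κ - 1) / (Real.sqrt κ + 1))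

lemma log_potential_sub_integral_log {a b : ℝ} (ha : 0 < a) (hab : a < b) :
    Real.log ((b - a) / 4) - ∫ y, Real.log |y| ∂(arcsineMeasure a b) = logRate (b / a) := by
  have hsa : Real.sqrt a ≠ 0 := (Real.sqrt_pos.2 ha).ne'
  have hsb : 0 < Real.sqrt b := Real.sqrt_pos.2 (ha.trans hab)
  rw [integral_log_arcsineMeasure ha hab, logRate, Real.sqrt_div (ha.trans hab).le, sub_sub_cancel]
  congr 1
  rw [div_sub_one hsa, div_add_one hsa, div_div_div_cancel_right₀ hsa]

/-! ### Swept measures and their potentials -/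

/-- The image of the arcsine distribution under an inversion centred at `w`; this is the sweeping
of the Dirac mass at `w` onto `[m, M]`. -/
noncomputable def sweptMeasure (m M w : ℝ) : Measure ℝ :=
  (arcsineMeasure (M - w)⁻¹ (m - w)⁻¹).map fun y => w + y⁻¹

section sweptMeasure

variable {m M w : ℝ}

lemma inv_sub_lt_inv_sub (hw : w < m) (hmM : m < M) : (M - w)⁻¹ < (m - w)⁻¹ :=
  (inv_lt_inv₀ (by linarith) (by linarith)).2 (by linarith)

lemma isProbabilityMeasure_sweptMeasure (hw : w < m) (hmM : m < M) :
    IsProbabilityMeasure (sweptMeasure m M w) :=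
  have := isProbabilityMeasure_arcsineMeasure (inv_sub_lt_inv_sub hw hmM)
  Measure.isProbabilityMeasure_map (by fun_prop)

lemma add_inv_mem_Ioo (hw : w < m) (hmM : m < M) {y : ℝ}
    (hy : y ∈ Ioo (M - w)⁻¹ (m - w)⁻¹) : w + y⁻¹ ∈ Ioo m M := by
  have hy0 : 0 < y := lt_trans (inv_pos.2 (by linarith)) hy.1
  have h1 := (inv_lt_comm₀ (by linarith) hy0).1 hy.1
  have h2 := (lt_inv_comm₀ hy0 (by linarith)).1 hy.2
  constructor <;> linarith

lemma inv_sub_mem_Ioo (hw : w < m) {x : ℝ} (hx : x ∈ Ioo m M) :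
    (x - w)⁻¹ ∈ Ioo (M - w)⁻¹ (m - w)⁻¹ :=
  ⟨(inv_lt_inv₀ (by linarith [hx.1, hx.2]) (by linarith [hx.1])).2 (by linarith [hx.2]),
    (inv_lt_inv₀ (by linarith [hx.1]) (by linarith)).2 (by linarith [hx.1])⟩

lemma sweptMeasure_absolutelyContinuous (hw : w < m) (hmM : m < M) :
    sweptMeasure m M w ≪ volume.restrict (Ioo m M) := by
  refine Measure.AbsolutelyContinuous.mk fun s hs h => ?_
  rw [Measure.restrict_apply hs] at h
  have hf : Measurable fun y : ℝ => w + y⁻¹ := by fun_prop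
  rw [sweptMeasure, Measure.map_apply hf hs]
  refine arcsineMeasure_absolutelyContinuous _ _ ?_
  rw [Measure.restrict_apply (hf hs)]
  -- The inversion is differentiable away from its pole, so it maps null sets to null sets.
  refine measure_mono_null (t := (fun x => (x - w)⁻¹) '' (s ∩ Ioo m M)) ?_ ?_
  · rintro y ⟨hy, hyI⟩
    exact ⟨w + y⁻¹, ⟨hy, add_inv_mem_Ioo hw hmM hyI⟩, by simp⟩
  · refine addHaar_image_eq_zero_of_differentiableOn_of_addHaar_eq_zero _ ?_ h
    intro x hx
    have : x - w ≠ 0 := by linarith [hx.2.1]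
    fun_prop (disch := assumption)

lemma absolutelyContinuous_sweptMeasure (hw : w < m) (hmM : m < M) :
    volume.restrict (Ioo m M) ≪ sweptMeasure m M w := by
  refine Measure.AbsolutelyContinuous.mk fun s hs h => ?_
  have hf : Measurable fun y : ℝ => w + y⁻¹ := by fun_prop
  rw [sweptMeasure, Measure.map_apply hf hs] at h
  have h' := absolutelyContinuous_arcsineMeasure _ _ h
  rw [Measure.restrict_apply (hf hs)] at h'
  rw [Measure.restrict_apply hs]
  refine measure_mono_null
    (t := (fun y : ℝ => w + y⁻¹) '' ((fun y => w + y⁻¹) ⁻¹' s ∩ Ioo (M - w)⁻¹ (m - w)⁻¹)) ?_ ?_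
  · rintro x ⟨hx, hxI⟩
    exact ⟨(x - w)⁻¹, ⟨by simpa using hx, inv_sub_mem_Ioo hw hxI⟩, by simp⟩
  · refine addHaar_image_eq_zero_of_differentiableOn_of_addHaar_eq_zero _ ?_ h'
    intro y hy
    have : y ≠ 0 := (lt_trans (inv_pos.2 (by linarith)) hy.2.1).ne'
    fun_prop (disch := assumption)

lemma ae_sweptMeasure_mem_Ioo (hw : w < m) (hmM : m < M) :
    ∀ᵐ x ∂(sweptMeasure m M w), x ∈ Ioo m M :=
  (sweptMeasure_absolutelyContinuous hw hmM).ae_le (ae_restrict_mem measurableSet_Ioo)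

lemma ae_sweptMeasure_ne (hw : w < m) (hmM : m < M) (β : ℝ) :
    ∀ᵐ x ∂(sweptMeasure m M w), x ≠ β :=
  (sweptMeasure_absolutelyContinuous hw hmM).ae_le (ae_restrict_of_ae (by simp [ae_iff]))

/-- Under `x = w + y⁻¹`, the distance `|x - β|` factors as `|y - (β - w)⁻¹| |y|⁻¹ |β - w|`. The
potential is thus an arcsine potential at `(β - w)⁻¹`, minus the one at `0`, plus `log |β - w|`, and
the equality case is inherited from the arcsine law. -/
lemma sweptMeasure_log_potential (hw : w < m) (hmM : m < M) {β : ℝ} (hβ : β ≠ w) :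
    Integrable (fun x => Real.log |x - β|) (sweptMeasure m M w) ∧
    logRate ((M - w) / (m - w)) + Real.log |β - w| ≤
      ∫ x, Real.log |x - β| ∂(sweptMeasure m M w) ∧
    (∫ x, Real.log |x - β| ∂(sweptMeasure m M w) =
      logRate ((M - w) / (m - w)) + Real.log |β - w| ↔ β ∈ Icc m M) := by
  have hab := inv_sub_lt_inv_sub hw hmM
  have ha : 0 < (M - w)⁻¹ := inv_pos.2 (by linarith)
  have hrate := log_potential_sub_integral_log ha hab
  rw [inv_div_inv] at hrate
  have := isProbabilityMeasure_arcsineMeasure hab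
  obtain ⟨i1, l1, e1⟩ := arcsineMeasure_log_potential hab (β - w)⁻¹
  have i0 := (arcsineMeasure_log_potential hab 0).1
  simp only [sub_zero] at i0
  have hβw : β - w ≠ 0 := sub_ne_zero.2 hβ
  have hae : ∀ᵐ y ∂(arcsineMeasure (M - w)⁻¹ (m - w)⁻¹),
      Real.log |y - (β - w)⁻¹| - Real.log |y| + Real.log |β - w| =
        Real.log |w + y⁻¹ - β| := by
    have h1 : ∀ᵐ y ∂(arcsineMeasure (M - w)⁻¹ (m - w)⁻¹), y ≠ (β - w)⁻¹ :=
      (arcsineMeasure_absolutelyContinuous _ _).ae_le (ae_restrict_of_ae (by simp [ae_iff]))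
    have h2 : ∀ᵐ y ∂(arcsineMeasure (M - w)⁻¹ (m - w)⁻¹), y ≠ 0 :=
      (arcsineMeasure_absolutelyContinuous _ _).ae_le (ae_restrict_of_ae (by simp [ae_iff]))
    filter_upwards [h1, h2] with y hy1 hy2
    have : w + y⁻¹ - β = -((y - (β - w)⁻¹) / y * (β - w)) := by
      field_simp
      ring
    rw [this, abs_neg, Real.log_abs, Real.log_abs, Real.log_abs, Real.log_abs,
      Real.log_mul (div_ne_zero (sub_ne_zero.2 hy1) hy2) hβw, Real.log_div (sub_ne_zero.2 hy1) hy2]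
  have hf : Measurable fun y : ℝ => w + y⁻¹ := by fun_prop
  have hg : Measurable fun x : ℝ => Real.log |x - β| := by fun_prop
  have i10 : Integrable (fun y => Real.log |y - (β - w)⁻¹| - Real.log |y|)
      (arcsineMeasure (M - w)⁻¹ (m - w)⁻¹) := i1.sub i0
  have hval : ∫ x, Real.log |x - β| ∂(sweptMeasure m M w) =
      ∫ y, Real.log |y - (β - w)⁻¹| ∂(arcsineMeasure (M - w)⁻¹ (m - w)⁻¹) -
      ∫ y, Real.log |y| ∂(arcsineMeasure (M - w)⁻¹ (m - w)⁻¹) + Real.log |β - w| := by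
    rw [sweptMeasure, integral_map hf.aemeasurable hg.aestronglyMeasurable,
      ← integral_congr_ae hae, integral_add i10 (integrable_const _),
      integral_sub i1 i0]
    simp
  refine ⟨?_, by rw [hval]; linarith, ?_⟩
  · rw [sweptMeasure, integrable_map_measure hg.aestronglyMeasurable hf.aemeasurable]
    exact (i10.add (integrable_const _)).congr hae
  · have h3 : ∀ A : ℝ, A - ∫ y, Real.log |y| ∂(arcsineMeasure (M - w)⁻¹ (m - w)⁻¹) +
        Real.log |β - w| = logRate ((M - w) / (m - w)) + Real.log |β - w| ↔
        A = Real.log (((m - w)⁻¹ - (M - w)⁻¹) / 4) := by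
      intro A
      rw [← hrate]
      constructor <;> intro h <;> linarith
    rw [hval, h3, e1]
    constructor
    · rintro ⟨h1, h2⟩
      have hp : 0 < β - w := inv_pos.1 (ha.trans_le h1)
      rw [inv_le_inv₀ (by linarith) hp] at h1
      rw [inv_le_inv₀ hp (by linarith)] at h2
      constructor <;> linarith
    · rintro ⟨h1, h2⟩
      exact ⟨(inv_le_inv₀ (by linarith) (by linarith)).2 (by linarith),
        (inv_le_inv₀ (by linarith) (by linarith)).2 (by linarith)⟩

end sweptMeasure

/-! ### From extended-real expectations to Bochner integrals -/

lemma log_contractionFactor {x β : ℝ} (h0 : β ≠ 0) (hx : x ≠ β) :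
    ENNReal.log (contractionFactor x β) = ((Real.log |x - β| - Real.log |β| : ℝ) : EReal) := by
  have h1 : |1 - β⁻¹ * x| = |x - β| / |β| := by
    rw [← abs_div, ← abs_neg]
    congr 1
    field_simp
    ring
  have h2 : |x - β| ≠ 0 := abs_ne_zero.2 (sub_ne_zero.2 hx)
  have h3 : |β| ≠ 0 := abs_ne_zero.2 h0
  rw [contractionFactor, if_neg h0, h1, ENNReal.log_ofReal_of_pos (by positivity),
    Real.log_div h2 h3]

lemma log_contractionFactor_zero (x : ℝ) : ENNReal.log (contractionFactor x 0) = ⊤ := by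
  simp [contractionFactor]

lemma log_contractionFactor_self {x : ℝ} (hx : x ≠ 0) :
    ENNReal.log (contractionFactor x x) = ⊥ := by
  simp [contractionFactor, hx]

lemma measurable_log_contractionFactor :
    Measurable fun p : ℝ × ℝ => ENNReal.log (contractionFactor p.1 p.2) := by
  refine ENNReal.measurable_log.comp (Measurable.ite ?_ measurable_const (by fun_prop))
  exact measurable_snd (measurableSet_singleton 0)

lemma extExpectation_congr_ae {μ : Measure ℝ} {f g : ℝ → EReal} (h : f =ᵐ[μ] g) :
    extExpectation μ f = extExpectation μ g := by
  have h1 : ∫⁻ β, (f β).toENNReal ∂μ = ∫⁻ β, (g β).toENNReal ∂μ :=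
    lintegral_congr_ae (h.mono fun β hβ => by simp only [hβ])
  have h2 : ∫⁻ β, (-f β).toENNReal ∂μ = ∫⁻ β, (-g β).toENNReal ∂μ :=
    lintegral_congr_ae (h.mono fun β hβ => by simp only [hβ])
  rw [extExpectation, extExpectation, h1, h2]

lemma extExpectation_coe {μ : Measure ℝ} {g : ℝ → ℝ} (hg : Integrable g μ) :
    extExpectation μ (fun β => (g β : EReal)) = ((∫ β, g β ∂μ : ℝ) : EReal) := by
  have h1 : ∫⁻ β, ENNReal.ofReal (g β) ∂μ ≠ ⊤ := hg.lintegral_lt_top.ne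
  have h2 : ∫⁻ β, ENNReal.ofReal (-g β) ∂μ ≠ ⊤ := hg.neg.lintegral_lt_top.ne
  rw [integral_eq_lintegral_pos_part_sub_lintegral_neg_part hg, EReal.coe_sub,
    EReal.coe_ennreal_toReal h1, EReal.coe_ennreal_toReal h2]
  simp [extExpectation, ← EReal.coe_neg]

/-- If both parts of the expectation are finite, then the expected log-contraction is an integral. -/
lemma log_contraction_of_finite {μ : Measure ℝ} {x : ℝ} (hx : x ≠ 0)
    (hp : ∫⁻ β, (ENNReal.log (contractionFactor x β)).toENNReal ∂μ ≠ ⊤)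
    (hn : ∫⁻ β, (-ENNReal.log (contractionFactor x β)).toENNReal ∂μ ≠ ⊤) :
    (∀ᵐ β ∂μ, β ≠ 0) ∧
    Integrable (fun β => Real.log |x - β| - Real.log |β|) μ ∧
    extExpectation μ (fun β => ENNReal.log (contractionFactor x β)) =
      ((∫ β, (Real.log |x - β| - Real.log |β|) ∂μ : ℝ) : EReal) ∧
    ∫⁻ β, ‖Real.log |x - β| - Real.log |β|‖ₑ ∂μ =
      ∫⁻ β, (ENNReal.log (contractionFactor x β)).toENNReal ∂μ +
      ∫⁻ β, (-ENNReal.log (contractionFactor x β)).toENNReal ∂μ := by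
  have hm : Measurable fun β => ENNReal.log (contractionFactor x β) :=
    measurable_log_contractionFactor.comp measurable_prodMk_left
  have hp1 := ae_lt_top hm.ereal_toENNReal hp
  have hn1 := ae_lt_top hm.neg.ereal_toENNReal hn
  have h0 : ∀ᵐ β ∂μ, β ≠ 0 := by
    filter_upwards [hp1] with β hβ h
    simp [h, log_contractionFactor_zero] at hβ
  have hx1 : ∀ᵐ β ∂μ, x ≠ β := by
    filter_upwards [hn1] with β hβ h
    subst h
    simp [log_contractionFactor_self hx] at hβ
  have hae : (fun β => ENNReal.log (contractionFactor x β)) =ᵐ[μ]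
      fun β => ((Real.log |x - β| - Real.log |β| : ℝ) : EReal) := by
    filter_upwards [h0, hx1] with β h1 h2 using log_contractionFactor h1 h2
  have hnorm : ∫⁻ β, ‖Real.log |x - β| - Real.log |β|‖ₑ ∂μ =
      ∫⁻ β, (ENNReal.log (contractionFactor x β)).toENNReal ∂μ +
      ∫⁻ β, (-ENNReal.log (contractionFactor x β)).toENNReal ∂μ := by
    rw [← lintegral_add_left hm.ereal_toENNReal]
    refine lintegral_congr_ae (hae.mono fun β hβ => ?_)
    simp only at hβ ⊢
    rw [hβ, ← EReal.coe_neg, EReal.real_coe_toENNReal, EReal.real_coe_toENNReal,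
      Real.enorm_eq_ofReal_abs]
    rcases le_total 0 (Real.log |x - β| - Real.log |β|) with h | h
    · rw [abs_of_nonneg h, ENNReal.ofReal_of_nonpos (neg_nonpos.2 h), add_zero]
    · rw [abs_of_nonpos h, ENNReal.ofReal_of_nonpos h, zero_add]
  have hint : Integrable (fun β => Real.log |x - β| - Real.log |β|) μ := by
    refine ⟨(by fun_prop : Measurable _).aestronglyMeasurable, ?_⟩
    rw [HasFiniteIntegral, hnorm]
    exact (ENNReal.add_ne_top.2 ⟨hp, hn⟩).lt_top
  exact ⟨h0, hint, (extExpectation_congr_ae hae).trans (extExpectation_coe hint), hnorm⟩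

lemma stepsizeObjective_arcsineMeasure_le {m M : ℝ} (hm : 0 < m) (hmM : m < M) :
    stepsizeObjective m M (arcsineMeasure m M) ≤ (logRate (M / m) : EReal) := by
  refine iSup₂_le fun x hx => ?_
  have hne : ∀ y : ℝ, ∀ᵐ β ∂(arcsineMeasure m M), β ≠ y := fun y =>
    (arcsineMeasure_absolutelyContinuous _ _).ae_le (ae_restrict_of_ae (by simp [ae_iff]))
  have hae : (fun β => ENNReal.log (contractionFactor x β)) =ᵐ[arcsineMeasure m M]
      fun β => ((Real.log |β - x| - Real.log |β| : ℝ) : EReal) := by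
    filter_upwards [hne 0, hne x] with β h1 h2
    rw [log_contractionFactor h1 h2.symm, abs_sub_comm]
  obtain ⟨i1, -, e1⟩ := arcsineMeasure_log_potential hmM x
  have i0 := (arcsineMeasure_log_potential hmM 0).1
  simp only [sub_zero] at i0
  have i10 : Integrable (fun β => Real.log |β - x| - Real.log |β|) (arcsineMeasure m M) :=
    i1.sub i0
  rw [extExpectation_congr_ae hae, extExpectation_coe i10, integral_sub i1 i0, e1.2 hx,
    log_potential_sub_integral_log hm hmM]

/-! ### Duality: the lower bound and its equality case -/

section lowerBound

variable {m M : ℝ}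

lemma sweptMeasure_zero_log_contraction (hm : 0 < m) (hmM : m < M) {β : ℝ} (hβ : β ≠ 0) :
    Integrable (fun x => Real.log |x - β| - Real.log |β|) (sweptMeasure m M 0) ∧
    logRate (M / m) ≤ ∫ x, (Real.log |x - β| - Real.log |β|) ∂(sweptMeasure m M 0) ∧
    (∫ x, (Real.log |x - β| - Real.log |β|) ∂(sweptMeasure m M 0) = logRate (M / m) ↔
      β ∈ Icc m M) := by
  have := isProbabilityMeasure_sweptMeasure hm hmM
  obtain ⟨i, l, e⟩ := sweptMeasure_log_potential hm hmM hβ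
  simp only [sub_zero] at l e
  have : ∫ x, (Real.log |x - β| - Real.log |β|) ∂(sweptMeasure m M 0) =
      ∫ x, Real.log |x - β| ∂(sweptMeasure m M 0) - Real.log |β| := by
    rw [integral_sub i (integrable_const _)]
    simp
  rw [this, ← e, sub_eq_iff_eq_add]
  exact ⟨i.sub (integrable_const _), by linarith, Iff.rfl⟩

/-- A bound uniform in `β` is what makes Fubini available for arbitrary `μ`: it controls the
negative parts, and the objective then controls the positive ones. -/
lemma lintegral_neg_log_contraction_le (hm : 0 < m) (hmM : m < M) (β : ℝ) :
    ∫⁻ x, (-ENNReal.log (contractionFactor x β)).toENNReal ∂(sweptMeasure m M 0) ≤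
      ENNReal.ofReal (Real.log (1 + 2 * M / m) - logRate (M / m)) := by
  have := isProbabilityMeasure_sweptMeasure hm hmM
  rcases eq_or_ne β 0 with rfl | h0
  · simp [log_contractionFactor_zero]
  have hI := ae_sweptMeasure_mem_Ioo hm hmM
  have hne := ae_sweptMeasure_ne hm hmM β
  obtain ⟨i, l, -⟩ := sweptMeasure_zero_log_contraction hm hmM h0
  have hM : 0 < M := hm.trans hmM
  -- For `β ≤ m / 2` the contraction factor is at least `1`, so the negative part vanishes. For `β >
  -- m / 2` its logarithm is at most `B = log (1 + 2M/m)`, and the negative part is dominated by the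
  -- nonnegative `B - log`, of integral at most `B - logRate (M / m)`.
  rcases le_or_gt β (m / 2) with hβ | hβ
  · refine le_of_eq_of_le ?_ zero_le
    rw [← lintegral_zero (μ := sweptMeasure m M 0)]
    refine lintegral_congr_ae ?_
    filter_upwards [hI, hne] with x hx hxβ
    rw [log_contractionFactor h0 hxβ, ← EReal.coe_neg, EReal.real_coe_toENNReal,
      ENNReal.ofReal_of_nonpos]
    have : |β| ≤ |x - β| := by
      rw [abs_of_pos (show 0 < x - β by linarith [hx.1]), abs_le]
      constructor <;> linarith [hx.1]
    linarith [Real.log_le_log (abs_pos.2 h0) this]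
  · have hβ0 : 0 < β := by linarith
    have hbound : ∀ᵐ x ∂(sweptMeasure m M 0), Real.log |x - β| - Real.log |β| ≤
        Real.log (1 + 2 * M / m) := by
      filter_upwards [hI, hne] with x hx hxβ
      have h1 : |x - β| ≤ (1 + 2 * M / m) * |β| := by
        rw [abs_of_pos hβ0]
        have h2 : M ≤ 2 * M / m * β := by
          rw [div_mul_eq_mul_div, le_div_iff₀ hm]
          nlinarith
        rw [abs_le]
        constructor <;> nlinarith [hx.1, hx.2]
      have h3 := Real.log_le_log (abs_pos.2 (sub_ne_zero.2 hxβ)) h1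
      rw [Real.log_mul (by positivity) (abs_pos.2 h0).ne'] at h3
      linarith
    have hB : 0 ≤ Real.log (1 + 2 * M / m) := Real.log_nonneg (by
      have : 0 < 2 * M / m := by positivity
      linarith)
    calc _ ≤ ∫⁻ x, ENNReal.ofReal (Real.log (1 + 2 * M / m) -
          (Real.log |x - β| - Real.log |β|)) ∂(sweptMeasure m M 0) := by
          refine lintegral_mono_ae ?_
          filter_upwards [hne] with x hxβ
          rw [log_contractionFactor h0 hxβ, ← EReal.coe_neg, EReal.real_coe_toENNReal]
          exact ENNReal.ofReal_le_ofReal (by linarith)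
      _ = ENNReal.ofReal (∫ x, (Real.log (1 + 2 * M / m) -
          (Real.log |x - β| - Real.log |β|)) ∂(sweptMeasure m M 0)) := by
          have iB : Integrable (fun x => Real.log (1 + 2 * M / m) -
            (Real.log |x - β| - Real.log |β|)) (sweptMeasure m M 0) := (integrable_const _).sub i
          rw [ofReal_integral_eq_lintegral_ofReal iB]
          filter_upwards [hbound] with x hx using sub_nonneg.2 hx
      _ ≤ _ := by
          refine ENNReal.ofReal_le_ofReal ?_
          rw [integral_sub (integrable_const _) i]
          simp only [integral_const, probReal_univ, smul_eq_mul, one_mul]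
          linarith

lemma integrable_log_contraction_prod (hm : 0 < m) (hmM : m < M) {μ : Measure ℝ}
    [IsProbabilityMeasure μ] {c : ℝ} (hc : stepsizeObjective m M μ ≤ (c : EReal)) :
    (∀ᵐ β ∂μ, β ≠ 0) ∧
    (∀ᵐ x ∂(sweptMeasure m M 0), Integrable (fun β => Real.log |x - β| - Real.log |β|) μ ∧
      ∫ β, (Real.log |x - β| - Real.log |β|) ∂μ ≤ c) ∧
    Integrable (fun p : ℝ × ℝ => Real.log |p.1 - p.2| - Real.log |p.2|)
      ((sweptMeasure m M 0).prod μ) := by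
  have := isProbabilityMeasure_sweptMeasure hm hmM
  have hmeas := measurable_log_contractionFactor
  have hmp := hmeas.ereal_toENNReal
  have hmn := hmeas.neg.ereal_toENNReal
  have hN : ∫⁻ x, ∫⁻ β, (-ENNReal.log (contractionFactor x β)).toENNReal ∂μ
      ∂(sweptMeasure m M 0) ≤ ENNReal.ofReal (Real.log (1 + 2 * M / m) - logRate (M / m)) := by
    rw [lintegral_lintegral_swap hmn.aemeasurable]
    calc _ ≤ ∫⁻ _, ENNReal.ofReal (Real.log (1 + 2 * M / m) - logRate (M / m)) ∂μ :=
          lintegral_mono fun β => lintegral_neg_log_contraction_le hm hmM β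
      _ = _ := by simp
  have hNtop := (hN.trans_lt ENNReal.ofReal_lt_top).ne
  have hNae := ae_lt_top hmn.lintegral_prod_right' hNtop
  have hI := ae_sweptMeasure_mem_Ioo hm hmM
  have hP : ∀ᵐ x ∂(sweptMeasure m M 0),
      ∫⁻ β, (ENNReal.log (contractionFactor x β)).toENNReal ∂μ ≤
        ENNReal.ofReal c + ∫⁻ β, (-ENNReal.log (contractionFactor x β)).toENNReal ∂μ := by
    filter_upwards [hNae, hI] with x hx hxI
    have h1 : extExpectation μ (fun β => ENNReal.log (contractionFactor x β)) ≤ (c : EReal) :=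
      (le_iSup₂ (f := fun x (_ : x ∈ Icc m M) =>
        extExpectation μ fun β => ENNReal.log (contractionFactor x β)) x
        (Ioo_subset_Icc_self hxI)).trans hc
    -- Since `∞ - ∞ = -∞`, the upper bound constrains the positive part only because the negative
    -- part is already known to be finite.
    rw [extExpectation, EReal.sub_le_iff_le_add (Or.inl (by simp)) (Or.inl (by simpa using hx.ne))]
      at h1
    rw [← EReal.coe_ennreal_le_coe_ennreal_iff, EReal.coe_ennreal_add, EReal.coe_ennreal_ofReal]
    refine h1.trans (add_le_add_left ?_ _)
    exact_mod_cast le_max_left c 0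
  have hfin : ∀ᵐ x ∂(sweptMeasure m M 0), x ≠ 0 ∧
      ∫⁻ β, (ENNReal.log (contractionFactor x β)).toENNReal ∂μ ≠ ⊤ ∧
      ∫⁻ β, (-ENNReal.log (contractionFactor x β)).toENNReal ∂μ ≠ ⊤ := by
    filter_upwards [hNae, hP, hI] with x hx hxP hxI
    exact ⟨(hm.trans hxI.1).ne',
      (hxP.trans_lt (ENNReal.add_lt_top.2 ⟨ENNReal.ofReal_lt_top, hx⟩)).ne, hx.ne⟩
  obtain ⟨x₀, h1, h2, h3⟩ := hfin.exists
  refine ⟨(log_contraction_of_finite h1 h2 h3).1, ?_, ?_⟩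
  · filter_upwards [hfin, hI] with x hx hxI
    obtain ⟨-, hi, he, -⟩ := log_contraction_of_finite hx.1 hx.2.1 hx.2.2
    refine ⟨hi, EReal.coe_le_coe_iff.1 (he ▸ ?_)⟩
    exact (le_iSup₂ (f := fun x (_ : x ∈ Icc m M) =>
        extExpectation μ fun β => ENNReal.log (contractionFactor x β)) x
        (Ioo_subset_Icc_self hxI)).trans hc
  · have hmg : Measurable fun p : ℝ × ℝ => Real.log |p.1 - p.2| - Real.log |p.2| := by fun_prop
    refine ⟨hmg.aestronglyMeasurable, ?_⟩
    rw [HasFiniteIntegral, lintegral_prod _ hmg.enorm.aemeasurable]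
    calc _ ≤ ∫⁻ x, (ENNReal.ofReal c +
          ∫⁻ β, (-ENNReal.log (contractionFactor x β)).toENNReal ∂μ +
          ∫⁻ β, (-ENNReal.log (contractionFactor x β)).toENNReal ∂μ) ∂(sweptMeasure m M 0) := by
          refine lintegral_mono_ae ?_
          filter_upwards [hfin, hP] with x hx hxP
          rw [(log_contraction_of_finite hx.1 hx.2.1 hx.2.2).2.2.2]
          gcongr
      _ < ⊤ := by
          have hmN : Measurable fun x =>
            ∫⁻ β, (-ENNReal.log (contractionFactor x β)).toENNReal ∂μ := hmn.lintegral_prod_right'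
          rw [lintegral_add_right _ hmN, lintegral_add_right _ hmN]
          simp [hNtop.lt_top]

lemma integral_integral_log_contraction (hm : 0 < m) (hmM : m < M) {μ : Measure ℝ}
    [IsProbabilityMeasure μ] {c : ℝ} (hc : stepsizeObjective m M μ ≤ (c : EReal)) :
    logRate (M / m) ≤ c ∧ (c = logRate (M / m) → (∀ᵐ β ∂μ, β ∈ Icc m M) ∧
      ∀ᵐ x ∂(sweptMeasure m M 0), Integrable (fun β => Real.log |x - β| - Real.log |β|) μ ∧
        ∫ β, (Real.log |x - β| - Real.log |β|) ∂μ = c) := by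
  have := isProbabilityMeasure_sweptMeasure hm hmM
  obtain ⟨h0, hx, hi⟩ := integrable_log_contraction_prod hm hmM hc
  have hswap := integral_integral_swap
    (f := fun x β : ℝ => Real.log |x - β| - Real.log |β|) hi
  have hi1 : Integrable (fun x => ∫ β, (Real.log |x - β| - Real.log |β|) ∂μ)
    (sweptMeasure m M 0) := hi.integral_prod_left
  have hi2 : Integrable (fun β => ∫ x, (Real.log |x - β| - Real.log |β|) ∂(sweptMeasure m M 0)) μ :=
    hi.integral_prod_right
  have hle1 : ∫ x, ∫ β, (Real.log |x - β| - Real.log |β|) ∂μ ∂(sweptMeasure m M 0) ≤ c := by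
    have := integral_mono_ae hi1 (integrable_const c) (hx.mono fun x h => h.2)
    simpa using this
  have hge : ∀ᵐ β ∂μ, logRate (M / m) ≤
      ∫ x, (Real.log |x - β| - Real.log |β|) ∂(sweptMeasure m M 0) :=
    h0.mono fun β h => (sweptMeasure_zero_log_contraction hm hmM h).2.1
  have hle2 : logRate (M / m) ≤
      ∫ β, ∫ x, (Real.log |x - β| - Real.log |β|) ∂(sweptMeasure m M 0) ∂μ := by
    have := integral_mono_ae (integrable_const _) hi2 hge
    simpa using this
  -- When `c` equals the rate, both one-sided bounds on the double integral are tight, so each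
  -- nonnegative gap has integral zero and vanishes almost everywhere.
  refine ⟨hle2.trans (hswap ▸ hle1), fun hcV => ⟨?_, ?_⟩⟩
  · have hz : ∫ β, (∫ x, (Real.log |x - β| - Real.log |β|) ∂(sweptMeasure m M 0) -
        logRate (M / m)) ∂μ = 0 := by
      rw [integral_sub hi2 (integrable_const _)]
      simp only [integral_const, probReal_univ, smul_eq_mul, one_mul]
      linarith
    rw [integral_eq_zero_iff_of_nonneg_ae (hge.mono fun β h => sub_nonneg.2 h)
      (hi2.sub (integrable_const _))] at hz
    filter_upwards [hz, h0] with β h1 h2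
    exact (sweptMeasure_zero_log_contraction hm hmM h2).2.2.1 (sub_eq_zero.1 h1)
  · have hz : ∫ x, (c - ∫ β, (Real.log |x - β| - Real.log |β|) ∂μ) ∂(sweptMeasure m M 0) = 0 := by
      rw [integral_sub (integrable_const _) hi1]
      simp only [integral_const, probReal_univ, smul_eq_mul, one_mul]
      linarith
    rw [integral_eq_zero_iff_of_nonneg_ae (hx.mono fun β h => sub_nonneg.2 h.2)
      ((integrable_const _).sub hi1)] at hz
    filter_upwards [hz, hx] with x h1 h2
    exact ⟨h2.1, (sub_eq_zero.1 h1).symm⟩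

end lowerBound

/-! ### Uniqueness: a measure is determined by its potential outside the interval -/

section transform

variable {m M : ℝ}

lemma integrable_of_continuousOn_of_ae_mem_Icc {μ : Measure ℝ} [IsFiniteMeasure μ]
    (hμ : ∀ᵐ β ∂μ, β ∈ Icc m M) {f : ℝ → ℝ} (hf : ContinuousOn f (Icc m M)) : Integrable f μ := by
  rw [← Measure.restrict_eq_self_of_ae_mem hμ]
  exact hf.integrableOn_compact isCompact_Icc

lemma hasDerivAt_integral_comp_sub {μ : Measure ℝ} [IsFiniteMeasure μ]
    (hμ : ∀ᵐ β ∂μ, β ∈ Icc m M) {K K' : ℝ → ℝ} (hK : ∀ t, 0 < t → HasDerivAt K (K' t) t)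
    (hK' : ContinuousOn K' (Ioi 0)) {w : ℝ} (hw : w < m) :
    HasDerivAt (fun w => ∫ β, K (β - w) ∂μ) (∫ β, -K' (β - w) ∂μ) w := by
  have hint : ∀ {f : ℝ → ℝ}, ContinuousOn f (Ioi 0) → ∀ w' < m,
      Integrable (fun β => f (β - w')) μ := fun hf w' hw' =>
    integrable_of_continuousOn_of_ae_mem_Icc hμ (hf.comp (by fun_prop) fun β hβ => by
      simp only [mem_Ioi]; linarith [hβ.1])
  have hKc : ContinuousOn K (Ioi 0) := fun t ht => (hK t ht).continuousAt.continuousWithinAt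
  -- On this neighbourhood `β - w'` stays in the compact set `[(m - w) / 2, M - w + 1] ⊆ (0, ∞)`, so
  -- a constant dominates the derivative.
  have hs : Ioo (w - 1) ((w + m) / 2) ∈ nhds w := Ioo_mem_nhds (by linarith) (by linarith)
  obtain ⟨C, hC⟩ := (isCompact_Icc (a := (m - w) / 2) (b := M - w + 1)).exists_bound_of_continuousOn
    (hK'.mono fun t ht => lt_of_lt_of_le (by linarith) ht.1)
  refine (hasDerivAt_integral_of_dominated_loc_of_deriv_le (bound := fun _ => C)
    (F' := fun w β => -K' (β - w)) hs ?_ (hint hKc w hw) ?_ ?_ (integrable_const _) ?_).2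
  · filter_upwards [hs] with w' hw'
    exact (hint hKc w' (by linarith [hw'.2])).aestronglyMeasurable
  · exact (hint hK' w hw).neg.aestronglyMeasurable
  · filter_upwards [hμ] with β hβ w' hw'
    rw [norm_neg]
    exact hC _ ⟨by linarith [hβ.1, hw'.2], by linarith [hβ.2, hw'.1]⟩
  · filter_upwards [hμ] with β hβ w' hw'
    have h1 := (hK (β - w') (by linarith [hβ.1, hw'.2])).comp w' ((hasDerivAt_id w').const_sub β)
    simpa [Function.comp_def] using h1

lemma integral_deriv_eq_of_integral_eq {μ ν : Measure ℝ} [IsFiniteMeasure μ] [IsFiniteMeasure ν]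
    (hμ : ∀ᵐ β ∂μ, β ∈ Icc m M) (hν : ∀ᵐ β ∂ν, β ∈ Icc m M) {K K' : ℝ → ℝ}
    (hK : ∀ t, 0 < t → HasDerivAt K (K' t) t) (hK' : ContinuousOn K' (Ioi 0)) {k : ℝ}
    (h : ∀ w < m, ∫ β, K (β - w) ∂μ = ∫ β, K (β - w) ∂ν + k) {w : ℝ} (hw : w < m) :
    ∫ β, K' (β - w) ∂μ = ∫ β, K' (β - w) ∂ν := by
  have h1 := hasDerivAt_integral_comp_sub hμ hK hK' hw
  have h2 := (hasDerivAt_integral_comp_sub hν hK hK' hw).add_const k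
  have h3 := h1.congr_of_eventuallyEq (f₁ := fun w => ∫ β, K (β - w) ∂ν + k) (by
    filter_upwards [Iio_mem_nhds hw] with w' hw' using (h w' hw').symm)
  have := h3.unique h2
  rw [integral_neg, integral_neg] at this
  exact neg_injective this

/-- Repeated differentiation in `w`: the first derivative removes `k`, and each further one raises
the power. The zeroth power compares total masses. -/
lemma integral_inv_sub_pow_eq {μ ν : Measure ℝ} [IsProbabilityMeasure μ] [IsProbabilityMeasure ν]
    (hμ : ∀ᵐ β ∂μ, β ∈ Icc m M) (hν : ∀ᵐ β ∂ν, β ∈ Icc m M) {k : ℝ}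
    (h : ∀ w < m, ∫ β, Real.log (β - w) ∂μ = ∫ β, Real.log (β - w) ∂ν + k) (n : ℕ) :
    ∀ w < m, ∫ β, (β - w)⁻¹ ^ n ∂μ = ∫ β, (β - w)⁻¹ ^ n ∂ν := by
  have hc : ContinuousOn (fun t : ℝ => t⁻¹) (Ioi 0) :=
    continuousOn_inv₀.mono fun t (ht : 0 < t) => ht.ne'
  rcases n with _ | n
  · simp
  induction n with
  | zero =>
    intro w hw
    simpa using integral_deriv_eq_of_integral_eq hμ hν (K := Real.log) (K' := fun t => t⁻¹)
      (fun t ht => Real.hasDerivAt_log ht.ne') hc h hw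
  | succ n ih =>
    intro w hw
    have hn : ((n + 1 : ℕ) : ℝ) ≠ 0 := by positivity
    have := integral_deriv_eq_of_integral_eq hμ hν (K := fun t => t⁻¹ ^ (n + 1))
      (K' := fun t => -((n + 1 : ℕ) : ℝ) * t⁻¹ ^ (n + 1 + 1)) (k := 0)
      (fun t ht => by
        refine ((hasDerivAt_inv ht.ne').fun_pow (n + 1)).congr_deriv ?_
        rw [Nat.add_sub_cancel, ← inv_pow]
        ring) (continuousOn_const.mul (hc.pow _)) (fun w hw => by simpa using ih w hw) hw
    rw [integral_const_mul, integral_const_mul] at this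
    exact mul_left_cancel₀ (neg_ne_zero.2 hn) this

/-- The logarithmic potential to the left of a compact interval determines, up to a constant, a
probability measure on that interval. -/
lemma eq_of_integral_log_sub_eq {μ ν : Measure ℝ} [IsProbabilityMeasure μ]
    [IsProbabilityMeasure ν] (hμ : ∀ᵐ β ∂μ, β ∈ Icc m M) (hν : ∀ᵐ β ∂ν, β ∈ Icc m M) {k : ℝ}
    (h : ∀ w < m, ∫ β, Real.log (β - w) ∂μ = ∫ β, Real.log (β - w) ∂ν + k) : μ = ν := by
  -- One base point suffices: all moments of `(β - (m - 1))⁻¹` agree, and this coordinate maps `[m,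
  -- M]` injectively into `(0, 1]`, where Weierstrass approximation applies.
  have hpow := fun n => integral_inv_sub_pow_eq hμ hν h n (m - 1) (by linarith)
  have hinv : ContinuousOn (fun β : ℝ => (β - (m - 1))⁻¹) (Icc m M) :=
    ContinuousOn.inv₀ (by fun_prop) fun β hβ => by linarith [hβ.1]
  have hpoly : ∀ p : Polynomial ℝ, ∀ ρ : Measure ℝ, [IsProbabilityMeasure ρ] →
      (∀ᵐ β ∂ρ, β ∈ Icc m M) → Integrable (fun β => p.eval (β - (m - 1))⁻¹) ρ := fun p ρ _ hρ =>
    integrable_of_continuousOn_of_ae_mem_Icc hρ (p.continuous.comp_continuousOn hinv)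
  have hpe : ∀ p : Polynomial ℝ,
      ∫ β, p.eval (β - (m - 1))⁻¹ ∂μ = ∫ β, p.eval (β - (m - 1))⁻¹ ∂ν := by
    intro p
    induction p using Polynomial.induction_on' with
    | add p q hp hq =>
      simp only [Polynomial.eval_add]
      rw [integral_add (hpoly p μ hμ) (hpoly q μ hμ), integral_add (hpoly p ν hν) (hpoly q ν hν),
        hp, hq]
    | monomial n a =>
      simp only [Polynomial.eval_monomial]
      rw [integral_const_mul, integral_const_mul, hpow]
  refine ext_of_forall_integral_eq_of_IsFiniteMeasure fun f => ?_
  have happrox : ∀ ε > 0, |∫ β, f β ∂μ - ∫ β, f β ∂ν| ≤ ε + ε := by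
    intro ε hε
    have hc : ContinuousOn (fun x : ℝ => f (m - 1 + x⁻¹)) (Icc (M - (m - 1))⁻¹ 1) := by
      rcases lt_or_ge M m with hMm | hMm
      · obtain ⟨β, hβ⟩ := hμ.exists
        linarith [hβ.1, hβ.2]
      · refine f.continuous.comp_continuousOn (continuousOn_const.add (continuousOn_inv₀.mono ?_))
        exact fun x hx => (lt_of_lt_of_le (inv_pos.2 (by linarith)) hx.1).ne'
    obtain ⟨p, hp⟩ := exists_polynomial_near_of_continuousOn _ _ _ hc ε hε
    have hclose : ∀ ρ : Measure ℝ, [IsProbabilityMeasure ρ] → (∀ᵐ β ∂ρ, β ∈ Icc m M) →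
        |∫ β, p.eval (β - (m - 1))⁻¹ ∂ρ - ∫ β, f β ∂ρ| ≤ ε := by
      intro ρ _ hρ
      rw [← integral_sub (hpoly p ρ hρ) (f.integrable ρ), ← Real.norm_eq_abs]
      refine (norm_integral_le_of_norm_le_const (C := ε) (hρ.mono fun β hβ => ?_)).trans (by simp)
      have h1 : 0 < β - (m - 1) := by linarith [hβ.1]
      have := hp (β - (m - 1))⁻¹ ⟨(inv_le_inv₀ (by linarith [hβ.1, hβ.2]) h1).2 (by linarith [hβ.2]),
        inv_le_one_of_one_le₀ (by linarith [hβ.1])⟩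
      rw [inv_inv, add_sub_cancel] at this
      exact this.le
    have h1 := abs_le.1 (hclose μ hμ)
    have h2 := abs_le.1 (hclose ν hν)
    rw [hpe p] at h1
    rw [abs_le]
    constructor <;> linarith [h1.1, h1.2, h2.1, h2.2]
  refine sub_eq_zero.1 (abs_eq_zero.1 (le_antisymm (le_of_forall_pos_le_add fun ε hε => ?_)
    (abs_nonneg _)))
  have := happrox (ε / 2) (by linarith)
  linarith

end transform

/-- The potential of `μ` is constant on `(m, M)` almost everywhere, so its integral against any
swept measure is that constant; Fubini evaluates the same integral through the swept potential. The
constant `L` depends on `μ` but not on `w`. -/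
lemma integral_log_sub_of_stepsizeObjective_le {m M : ℝ} (hm : 0 < m) (hmM : m < M)
    {μ : Measure ℝ} [IsProbabilityMeasure μ]
    (hμ : stepsizeObjective m M μ ≤ (logRate (M / m) : EReal)) :
    (∀ᵐ β ∂μ, β ∈ Icc m M) ∧ ∃ L : ℝ, ∀ w < m,
      logRate ((M - w) / (m - w)) + ∫ β, Real.log (β - w) ∂μ = L := by
  obtain ⟨hI, hpot⟩ := (integral_integral_log_contraction hm hmM hμ).2 rfl
  have hlog : ∀ w < m, Integrable (fun β => Real.log (β - w)) μ := fun w hw =>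
    integrable_of_continuousOn_of_ae_mem_Icc hI
      (ContinuousOn.log (by fun_prop) fun β hβ => by linarith [hβ.1])
  refine ⟨hI, logRate (M / m) + ∫ β, Real.log |β| ∂μ, fun w hw => ?_⟩
  have := isProbabilityMeasure_sweptMeasure hw hmM
  have hΦ : ∀ᵐ x ∂(sweptMeasure m M w), ∫ β, Real.log |x - β| ∂μ =
      logRate (M / m) + ∫ β, Real.log |β| ∂μ := by
    -- The optimality information holds `ρ_0`-almost everywhere; it passes to `ρ_w` through Lebesgue
    -- measure on `(m, M)`.
    refine ((sweptMeasure_absolutelyContinuous hw hmM).trans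
      (absolutelyContinuous_sweptMeasure hm hmM)).ae_le ?_
    filter_upwards [hpot] with x hx
    have i0 : Integrable (fun β => Real.log |β|) μ := by simpa using hlog 0 hm
    rw [← hx.2, ← integral_add hx.1 i0]
    simp
  have hxI := ae_sweptMeasure_mem_Ioo hw hmM
  have hmeas : Measurable fun p : ℝ × ℝ => Real.log |p.1 - p.2| := by fun_prop
  have hpt : ∀ β ∈ Icc m M, Integrable (fun x => Real.log |x - β|) (sweptMeasure m M w) ∧
      ∫ x, Real.log |x - β| ∂(sweptMeasure m M w) =
        logRate ((M - w) / (m - w)) + Real.log (β - w) := by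
    intro β hβ
    obtain ⟨h1, -, h2⟩ := sweptMeasure_log_potential hw hmM (show β ≠ w by linarith [hβ.1])
    rw [h2.2 hβ, Real.log_abs]
    exact ⟨h1, rfl⟩
  have hint : Integrable (fun p : ℝ × ℝ => Real.log |p.1 - p.2|)
      ((sweptMeasure m M w).prod μ) := by
    refine (integrable_prod_iff' hmeas.aestronglyMeasurable).2 ⟨hI.mono fun β hβ => (hpt β hβ).1, ?_⟩
    -- As `log |x - β| ≤ log (M - m)`, one has `|log |x - β|| ≤ 2 |log (M - m)| - log |x - β|`; the
    -- swept potential integrates the right-hand side in `x`.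
    refine Integrable.mono' (g := fun β => 2 * |Real.log (M - m)| -
      (logRate ((M - w) / (m - w)) + Real.log (β - w)))
      ((integrable_const _).sub ((integrable_const _).add (hlog w hw)))
      hmeas.norm.stronglyMeasurable.integral_prod_left'.aestronglyMeasurable ?_
    filter_upwards [hI] with β hβ
    obtain ⟨h1, h2⟩ := hpt β hβ
    rw [Real.norm_of_nonneg (integral_nonneg fun x => norm_nonneg _), ← h2]
    have h3 : ∫ x, (2 * |Real.log (M - m)| - Real.log |x - β|) ∂(sweptMeasure m M w) =
        2 * |Real.log (M - m)| - ∫ x, Real.log |x - β| ∂(sweptMeasure m M w) := by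
      rw [integral_sub (integrable_const _) h1]
      simp
    rw [← h3]
    refine integral_mono_ae h1.norm ((integrable_const _).sub h1) ?_
    filter_upwards [hxI, ae_sweptMeasure_ne hw hmM β] with x hx hxβ
    have h4 : |x - β| ≤ M - m := abs_le.2
      ⟨by linarith [hx.1, hβ.2], by linarith [hx.2, hβ.1]⟩
    have h5 := Real.log_le_log (abs_pos.2 (sub_ne_zero.2 hxβ)) h4
    have h6 := le_abs_self (Real.log (M - m))
    rw [Real.norm_eq_abs]
    refine abs_le'.2 ⟨?_, ?_⟩ <;> linarith [abs_nonneg (Real.log (M - m))]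
  have hswap := integral_integral_swap (f := fun x β : ℝ => Real.log |x - β|) hint
  rw [integral_congr_ae hΦ, integral_congr_ae (hI.mono fun β hβ => (hpt β hβ).2),
    integral_add (integrable_const _) (hlog w hw)] at hswap
  simpa using hswap.symm

theorem mainTheorem2 (m M : ℝ) (hm : 0 < m) (hmM : m < M) :
    IsProbabilityMeasure (arcsineMeasure m M) ∧
    (⨅ μ : ProbabilityMeasure ℝ, stepsizeObjective m M (μ : Measure ℝ)) =
      ((Real.log ((Real.sqrt (M / m) - 1) / (Real.sqrt (M / m) + 1)) : ℝ) : EReal) ∧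
    ∀ μ : ProbabilityMeasure ℝ,
      (∀ ν : ProbabilityMeasure ℝ,
        stepsizeObjective m M (μ : Measure ℝ) ≤ stepsizeObjective m M (ν : Measure ℝ)) ↔
      (μ : Measure ℝ) = arcsineMeasure m M := by
  have hprob := isProbabilityMeasure_arcsineMeasure hmM
  have hle := stepsizeObjective_arcsineMeasure_le hm hmM
  have hge : ∀ μ : ProbabilityMeasure ℝ,
      (logRate (M / m) : EReal) ≤ stepsizeObjective m M (μ : Measure ℝ) := by
    intro μ
    -- Comparing with real `c` above the objective covers the values `±∞` as well.
    refine EReal.le_of_forall_lt_iff_le.1 fun c hc => ?_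
    exact EReal.coe_le_coe_iff.2 (integral_integral_log_contraction hm hmM hc.le).1
  refine ⟨hprob, ?_, fun μ => ⟨fun h => ?_, fun h ν => ?_⟩⟩
  · change _ = ((logRate (M / m) : ℝ) : EReal)
    refine le_antisymm (le_trans ?_ hle) (le_iInf hge)
    exact iInf_le (fun μ : ProbabilityMeasure ℝ => stepsizeObjective m M (μ : Measure ℝ))
      ⟨arcsineMeasure m M, hprob⟩
  · obtain ⟨hI, L, hL⟩ := integral_log_sub_of_stepsizeObjective_le hm hmM
      ((h ⟨arcsineMeasure m M, hprob⟩).trans hle)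
    obtain ⟨hI', L', hL'⟩ := integral_log_sub_of_stepsizeObjective_le hm hmM hle
    exact eq_of_integral_log_sub_eq hI hI' (k := L - L') fun w hw => by
      linarith [hL w hw, hL' w hw]
  · rw [h]
    exact hle.trans (hge ν)
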